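/- **Theorem 3 (Soundness).** *Setting.* A heap is a finite-support map from addresses to typed values together with a next free address (all addresses from it on are unused). A monotonic reference $r$ of type $\mathsf{mref}\ a\ rel$ is a typed address with a preorder $rel$ on $a$; references $\mathsf{ref}\ a$ have the trivial preorder. Write $h_0\preceq h_1$ if every reference contained in $h_0$ is contained in $h_1$, with $rel$-related contents. Computations $m$ with result in $a$ are the elements of the free monad with operations read, write, alloc, witness $p$ and recall $p$ (for heap predicates $p$ stable under $\preceq$), and a partial call depending on a proposition. The morphism $\theta$ assigns to $m$ its weakest-precondition transformer: read requires containment; write requires containment and that the old and new value are related by the preorder; alloc uses the next free address; witness $p$ requires $p$ now and provides the token $\mathsf{witnessed}\ p$; recall $p$ requires the token and provides $p$ now; a partial call requires its proposition. The tokens are arbitrary propositions depending on $p$. $\mathsf{MST}\ a\ pre\ post$ is the type of those $m$ such that $pre\ h_0\wedge\forall v\,h_1.\,(h_0\preceq h_1\wedge post\ h_0\ v\ h_1\Rightarrow p\ v\ h_1)$ implies $\theta\,m\,p\,h_0$, for all $p,h_0$. A fixed monotonic reference $\mathsf{label\_map}$ stores a map from addresses to labels (private, shareable, encapsulated; only private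 may change). Full ground types are built from unit, int, bool by sums, products, references and mutable linked lists. The invariant $\mathsf{lr\_inv}\ h$ says: references of full ground type contained in $h$ point to values all of whose references are contained; shareable ones point to values all of whose references are shareable; $\mathsf{label\_map}$ is contained and private; and all addresses from the next free one on are private. $\mathsf{LR}\ a\ pre\ post$ is $\mathsf{MST}$ with $\mathsf{lr\_inv}$ added to the pre- and the post-condition. The concrete predicates are $\mathcal I_c=\mathsf{lr\_inv}$; $\varphi_c\,r$: being contained and being shareable are both witnessed for $r$; $h_0\preccurlyeq_c h_1$: among references existing in $h_0$, only shareable and encapsulated ones (and $\mathsf{label\_map}$) are modified, and all of them stay, with the same labels. *Interfaces.* A source interface $I^S$ consists of, for all triples $\pi=(\mathcal I,\varphi,\preccurlyeq)$ (a heap invariant, a predicate on references, a preorder on heaps), a type $\mathsf{ctype}\,\pi$ and a tree $\mathsf{specs}\,\pi$ of pre- and post-conditions; a tree $\mathsf{hocs}$ of contracts (dynamic checks) for $\mathsf{specs}$ at the concrete predicates; for all $\pi$, an intermediate type $\mathsf{ityp}\,\pi$ for the interface of unverified code and a function $\mathsf{safe\_import}_\pi$ that maps a value of $\mathsf{ityp}\,\pi$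 and a tree of contracts for $\mathsf{specs}\,\pi$ to a value of $\mathsf{ctype}\,\pi$ and preserves every predicate on the references occurring in values; and a post-condition $\psi$, a relation between the initial heap, an integer result and the final heap. A partial source program verified against $I^S$ is a function $P:\mathsf{ctype}(\mathcal I_c,\varphi_c,\preccurlyeq_c)\to\mathsf{LR}\ \mathsf{int}\ \top\ \psi$. A target context for the compiled interface is a function $C^T$ that takes any $\mathcal I,\varphi,\preccurlyeq$ and operations alloc, read and write on references of full ground types, specified only through $\mathcal I,\varphi,\preccurlyeq$ (all operations require and ensure $\mathcal I$ and evolve the heap along $\preccurlyeq$; all references passed to or returned by them satisfy $\varphi$), and returns a value of $\mathsf{ityp}(\mathcal I,\varphi,\preccurlyeq)$. The compiled program $\llbracket P\rrbracket$ maps $c:\mathsf{ityp}(\mathcal I_c,\varphi_c,\preccurlyeq_c)$ to $P(\mathsf{safe\_import}\ c\ \mathsf{hocs})$. Linking gives the whole target program $C^T[\llbracket P\rrbracket]=\lambda().\,\llbracket P\rrbracket(C^T\ \mathcal I_c\ \varphi_c\ \preccurlyeq_c\ \mathsf{ctx\_alloc}\ \mathsf{ctx\_read}\ \mathsf{ctx\_write})$,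 where $\mathsf{ctx\_alloc}$ allocates a reference and labels it shareable, and $\mathsf{ctx\_read}$, $\mathsf{ctx\_write}$ read and write. For a whole program $W:\mathsf{unit}\to\mathsf{LR}\ \mathsf{int}\ \top\ \top$ let $\mathsf{beh}(W)\ h_0\ r\ h_1$ hold if $p\ r\ h_1$ for all $p$ with $\theta\,(W())\,p\,h_0$. *Claim.* For every source interface $I^S$, every partial source program $P$ verified against $I^S$ and every target context $C^T$ for the compiled interface, $\mathsf{beh}(C^T[\llbracket P\rrbracket])\subseteq\psi$ on initial heaps that satisfy the invariant: for all $h_0,r,h_1$ with $\mathsf{lr\_inv}\ h_0$, if $\mathsf{beh}(C^T[\llbracket P\rrbracket])\ h_0\ r\ h_1$ then $\psi\ h_0\ r\ h_1$. -/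

import Mathlib

universe u v w

noncomputable section

namespace SecRef

/-! ### Preorders, labels, full ground types -/

/-- A preorder on `α`, as a relation bundled with reflexivity and transitivity. -/
structure PreorderRel (α : Type u) : Type u where
  rel : α → α → Prop
  refl : ∀ x, rel x x
  trans : ∀ x y z, rel x y → rel y z → rel x z

/-- The preorder relating all values. -/
def PreorderRel.total (α : Type u) : PreorderRel α :=
  ⟨fun _ _ => True, fun _ => trivial, fun _ _ _ _ _ => trivial⟩

inductive Label : Type
  | priv
  | shareable
  | encapsulated

/-- `Private` may become anything, the two other labels are permanent. -/
def Label.le : Label → Label → Prop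
  | .priv, _ => True
  | .shareable, .shareable => True
  | .encapsulated, .encapsulated => True
  | _, _ => False

/-- Deep embedding of the types that shareable references can store values of. -/
inductive FullGroundTyp : Type
  | unit
  | int
  | bool
  | sum (t₁ t₂ : FullGroundTyp)
  | pair (t₁ t₂ : FullGroundTyp)
  | ref (t : FullGroundTyp)
  | llist (t : FullGroundTyp)

/-- The types of heap cells: the full ground types with the trivial preorder (the cells of
ML-style references `ref (to_Type t)`), and arbitrary small types with an arbitrary preorder (the
cells of `mref a rel`).  References are indexed by these codes instead of by bare types since type
constructors of F* are injective and pairwise distinct, which equality of Lean types does not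
reflect: with codes, a cell of type `to_Type t` determines `t`. -/
inductive CellTyp : Type 1
  | ground (t : FullGroundTyp)
  | mono (α : Type) (rel : PreorderRel α)

/-- Monotonic references: typed addresses. -/
structure MRef (c : CellTyp) : Type where
  addr : ℕ+

/-- ML-style references to values of a full ground type. -/
abbrev Ref (t : FullGroundTyp) : Type := MRef (.ground t)

/-- Mutable linked lists with entries in `α` (the values of type `t`); the tail is a reference to a
linked list of the same type. -/
inductive LinkedList (t : FullGroundTyp) (α : Type) : Type
  | nil
  | cons (head : α) (tail : Ref (.llist t))

def FullGroundTyp.toType : FullGroundTyp → Type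
  | .unit => Unit
  | .int => ℤ
  | .bool => Bool
  | .sum t₁ t₂ => t₁.toType ⊕ t₂.toType
  | .pair t₁ t₂ => t₁.toType × t₂.toType
  | .ref t => Ref t
  | .llist t => LinkedList t t.toType

/-- The type of the values stored in a cell. -/
@[reducible] def CellTyp.El : CellTyp → Type
  | .ground t => t.toType
  | .mono α _ => α

/-- The preorder along which the value stored in a cell may evolve. -/
def CellTyp.rel : (c : CellTyp) → PreorderRel c.El
  | .ground t => PreorderRel.total t.toType
  | .mono _ rel => rel

/-! ### Monotonic heaps -/

/-- Heaps: partial maps from addresses to typed values, all addresses from `nextAddr` on being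
unused. -/
structure Heap : Type 1 where
  nextAddr : ℕ+
  mem : ℕ+ → Option (Σ c : CellTyp, c.El)
  unused : ∀ a, nextAddr ≤ a → mem a = none

/-- `h` contains `r`: the address of `r` is allocated, at the type and preorder of `r`. -/
def Heap.Contains (h : Heap) {c : CellTyp} (r : MRef c) : Prop :=
  ∃ x : c.El, h.mem r.addr = some ⟨c, x⟩

open Classical in
/-- The value of `r` in `h`, if `h` contains `r` (and `none` otherwise). -/
def Heap.sel (h : Heap) {c : CellTyp} (r : MRef c) : Option c.El :=
  if hc : h.Contains r then some hc.choose else none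

/-- Overwrite the value of a contained reference. -/
def Heap.write (h : Heap) {c : CellTyp} (r : MRef c) (hc : h.Contains r) (x : c.El) : Heap where
  nextAddr := h.nextAddr
  mem := Function.update h.mem r.addr (some ⟨c, x⟩)
  unused := by
    intro a ha
    obtain ⟨y, hy⟩ := hc
    have hne : a ≠ r.addr := by
      rintro rfl
      rw [h.unused _ ha] at hy
      cases hy
    rw [Function.update_of_ne hne]
    exact h.unused a ha

/-- Allocate a fresh reference, at the next free address. -/
def Heap.alloc (h : Heap) {c : CellTyp} (x : c.El) : MRef c × Heap :=
  (⟨h.nextAddr⟩,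
    { nextAddr := h.nextAddr + 1
      mem := Function.update h.mem h.nextAddr (some ⟨c, x⟩)
      unused := by
        intro a ha
        have hlt : h.nextAddr < a := lt_of_lt_of_le (PNat.lt_add_right _ _) ha
        rw [Function.update_of_ne (ne_of_gt hlt)]
        exact h.unused a hlt.le })

/-- The preorder on heaps: allocated references stay allocated, and their values evolve along their
own preorders. -/
def Heap.le (h₀ h₁ : Heap) : Prop :=
  ∀ (c : CellTyp) (r : MRef c) (x : c.El), h₀.sel r = some x →
    ∃ y, h₁.sel r = some y ∧ c.rel.rel x y

abbrev HeapPred : Type 1 := Heap → Prop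

/-- Heap predicates that are preserved along the preorder on heaps. -/
def StablePred : Type 1 := {p : HeapPred // ∀ h₀ h₁, p h₀ → h₀.le h₁ → p h₁}

/-! ### The computational monad, the specification monad, and the Dijkstra monad -/

/-- The free monad of computations on the monotonic heap.  `partialCall` accounts for
pre-conditions: the rest of the computation may depend on the validity of a proposition. -/
inductive MstRepr (α : Type u) : Type (max 1 u)
  | ret (x : α) : MstRepr α
  | read {c : CellTyp} (r : MRef c) (k : c.El → MstRepr α) : MstRepr α
  | write {c : CellTyp} (r : MRef c) (x : c.El) (k : MstRepr α) : MstRepr α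
  | alloc {c : CellTyp} (init : c.El) (k : MRef c → MstRepr α) : MstRepr α
  | witness (p : StablePred) (k : Unit → MstRepr α) : MstRepr α
  | recallTok (p : StablePred) (k : Unit → MstRepr α) : MstRepr α
  | partialCall (pre : Prop) (k : pre → MstRepr α) : MstRepr α

def MstRepr.bind {α : Type u} {β : Type v} : MstRepr α → (α → MstRepr β) → MstRepr β
  | .ret x, f => f x
  | .read r k, f => .read r fun x => (k x).bind f
  | .write r x k, f => .write r x (k.bind f)
  | .alloc init k, f => .alloc init fun r => (k r).bind f
  | .witness p k, f => .witness p fun t => (k t).bind f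
  | .recallTok p k, f => .recallTok p fun t => (k t).bind f
  | .partialCall pre k, f => .partialCall pre fun hp => (k hp).bind f

/-- Weakest-precondition specifications: monotone predicate transformers. -/
structure MstW (α : Type u) : Type (max 1 u) where
  wp : (α → Heap → Prop) → Heap → Prop
  mono : ∀ post post' : α → Heap → Prop, (∀ x h₁, post x h₁ → post' x h₁) →
    ∀ h₀, wp post h₀ → wp post' h₀

def MstW.ret {α : Type u} (x : α) : MstW α where
  wp post h₀ := post x h₀
  mono _ _ hpp h₀ := hpp x h₀

def MstW.bind {α : Type u} {β : Type v} (m : MstW α) (f : α → MstW β) : MstW β where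
  wp post h₀ := m.wp (fun x h₁ => (f x).wp post h₁) h₀
  mono _ _ hpp h₀ := m.mono _ _ (fun x h₁ => (f x).mono _ _ hpp h₁) h₀

/-- `m` refines `m'`: whenever `m'` guarantees a post-condition, so does `m`. -/
def MstW.Refines {α : Type u} (m m' : MstW α) : Prop :=
  ∀ post h₀, m'.wp post h₀ → m.wp post h₀

/-- Reading requires the reference to be contained. -/
def readW {c : CellTyp} (r : MRef c) : MstW c.El where
  wp post h₀ := ∃ x, h₀.sel r = some x ∧ post x h₀
  mono := by
    rintro _ _ hpp h₀ ⟨x, hx, hp⟩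
    exact ⟨x, hx, hpp _ _ hp⟩

/-- Writing requires the reference to be contained and the old value to be related to the new
one. -/
def writeW {c : CellTyp} (r : MRef c) (x : c.El) : MstW Unit where
  wp post h₀ := ∃ hc : h₀.Contains r,
    (∀ y, h₀.sel r = some y → c.rel.rel y x) ∧ post () (h₀.write r hc x)
  mono := by
    rintro _ _ hpp h₀ ⟨hc, hr, hp⟩
    exact ⟨hc, hr, hpp _ _ hp⟩

def allocW {c : CellTyp} (init : c.El) : MstW (MRef c) where
  wp post h₀ := post (h₀.alloc init).1 (h₀.alloc init).2
  mono _ _ hpp _ := hpp _ _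

def witnessW (witnessed : HeapPred → Prop) (p : StablePred) : MstW Unit where
  wp post h₀ := p.1 h₀ ∧ (witnessed p.1 → post () h₀)
  mono _ _ hpp _ hp := ⟨hp.1, fun hw => hpp _ _ (hp.2 hw)⟩

def recallW (witnessed : HeapPred → Prop) (p : StablePred) : MstW Unit where
  wp post h₀ := witnessed p.1 ∧ (p.1 h₀ → post () h₀)
  mono _ _ hpp _ hp := ⟨hp.1, fun hh => hpp _ _ (hp.2 hh)⟩

/-- The computation may rely on `pre` after the call, hence `pre` is required. -/
def partialCallW (pre : Prop) : MstW (PLift pre) where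
  wp post h₀ := ∃ hp : pre, post ⟨hp⟩ h₀
  mono := by
    rintro _ _ hpp h₀ ⟨hp, hq⟩
    exact ⟨hp, hpp _ _ hq⟩

/-- The monad morphism that infers the most precise specification of a computation.  The tokens
`witnessed p` are abstract propositions: everything below is parametric in them, and nothing is
assumed about them. -/
def theta (witnessed : HeapPred → Prop) {α : Type u} : MstRepr α → MstW α
  | .ret x => .ret x
  | .read r k => (readW r).bind fun x => theta witnessed (k x)
  | .write r x k => (writeW r x).bind fun _ => theta witnessed k
  | .alloc init k => (allocW init).bind fun r => theta witnessed (k r)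
  | .witness p k => (witnessW witnessed p).bind fun t => theta witnessed (k t)
  | .recallTok p k => (recallW witnessed p).bind fun t => theta witnessed (k t)
  | .partialCall pre k => (partialCallW pre).bind fun hp => theta witnessed (k hp.down)

/-- The specification given by a pre- and a post-condition; heaps moreover evolve along the
preorder on heaps. -/
def hoareW {α : Type u} (pre : Heap → Prop) (post : Heap → α → Heap → Prop) : MstW α where
  wp p h₀ := pre h₀ ∧ ∀ x h₁, h₀.le h₁ ∧ post h₀ x h₁ → p x h₁
  mono _ _ hpp _ hp := ⟨hp.1, fun x h₁ hx => hpp _ _ (hp.2 x h₁ hx)⟩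

/-- The Dijkstra monad: computations refined by a specification. -/
def MstDm (witnessed : HeapPred → Prop) (α : Type u) (m : MstW α) : Type (max 1 u) :=
  {c : MstRepr α // (theta witnessed c).Refines m}

/-- The effect of monotonic state, with a pre- and a post-condition. -/
abbrev MST (witnessed : HeapPred → Prop) (α : Type u) (pre : Heap → Prop)
    (post : Heap → α → Heap → Prop) : Type (max 1 u) :=
  MstDm witnessed α (hoareW pre post)

/-! ### Labels of references and the global invariant -/

def labelPreorder : PreorderRel (ℕ+ → Label) where
  rel m₀ m₁ := ∀ a, (m₀ a).le (m₁ a)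
  refl m a := by cases m a <;> trivial
  trans m₀ m₁ m₂ h h' a := by
    have h1 := h a
    have h2 := h' a
    revert h1 h2
    cases m₀ a <;> cases m₁ a <;> cases m₂ a <;> simp [Label.le]

/-- The cell type of the monotonic reference that stores the map from addresses to labels. -/
abbrev labelCell : CellTyp := .mono (ℕ+ → Label) labelPreorder

/-- References holding a label map. -/
abbrev LabelMap : Type := MRef labelCell

/-- The label of an address, if the heap contains the label map. -/
def labelAt (labelMap : LabelMap) (h : Heap) (a : ℕ+) : Option Label :=
  (h.sel labelMap).map fun m : ℕ+ → Label => m a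

/-- Predicates on references. -/
abbrev MRefPred : Type 1 := ∀ c : CellTyp, MRef c → Prop

def isContained {c : CellTyp} (r : MRef c) (h : Heap) : Prop := h.Contains r

def isShareable (labelMap : LabelMap) {c : CellTyp} (r : MRef c) (h : Heap) : Prop :=
  labelAt labelMap h r.addr = some .shareable

def isEncaps (labelMap : LabelMap) {c : CellTyp} (r : MRef c) (h : Heap) : Prop :=
  labelAt labelMap h r.addr = some .encapsulated

def isPrivateAddr (labelMap : LabelMap) (a : ℕ+) (h : Heap) : Prop :=
  labelAt labelMap h a = some .priv

/-- Every reference occurring in a value of full ground type satisfies `pred` (references are not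
followed). -/
def forallRefs (pred : MRefPred) : (t : FullGroundTyp) → t.toType → Prop
  | .unit, _ => True
  | .int, _ => True
  | .bool, _ => True
  | .sum t₁ _, Sum.inl x => forallRefs pred t₁ x
  | .sum _ t₂, Sum.inr x => forallRefs pred t₂ x
  | .pair t₁ t₂, x => forallRefs pred t₁ x.1 ∧ forallRefs pred t₂ x.2
  | .ref t, x => pred (.ground t) x
  | .llist _, LinkedList.nil => True
  | .llist t, LinkedList.cons x r => forallRefs pred t x ∧ pred (.ground (.llist t)) r

/-- Contained ML-style references that satisfy `pred` point to values all of whose references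
satisfy `pred`. -/
def transForallRefsHeap (h : Heap) (pred : ∀ c : CellTyp, MRef c → Heap → Prop) : Prop :=
  ∀ (t : FullGroundTyp) (r : Ref t) (x : t.toType), h.sel r = some x → pred _ r h →
    forallRefs (fun c r' => pred c r' h) t x

/-- The global invariant of labeled references. -/
def lrInv (labelMap : LabelMap) (h : Heap) : Prop :=
  transForallRefsHeap h (fun _ r => isContained r) ∧
  transForallRefsHeap h (fun _ r => isShareable labelMap r) ∧
  h.Contains labelMap ∧
  isPrivateAddr labelMap labelMap.addr h ∧
  ∀ a, h.nextAddr ≤ a → isPrivateAddr labelMap a h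

/-- The effect of labeled references. -/
abbrev LR (witnessed : HeapPred → Prop) (labelMap : LabelMap) (α : Type u) (pre : Heap → Prop)
    (post : Heap → α → Heap → Prop) : Type (max 1 u) :=
  MST witnessed α (fun h₀ => lrInv labelMap h₀ ∧ pre h₀)
    (fun h₀ x h₁ => lrInv labelMap h₁ ∧ post h₀ x h₁)

/-- Only shareable and encapsulated references (and the label map itself) are modified. -/
def modifShareableAndEncaps (labelMap : LabelMap) (h₀ h₁ : Heap) : Prop :=
  ∀ (c : CellTyp) (r : MRef c), h₀.Contains r → r.addr ≠ labelMap.addr →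
    ¬ (isShareable labelMap r h₀ ∨ isEncaps labelMap r h₀) → h₀.sel r = h₁.sel r

/-- Existing references stay, with the same label. -/
def sameLabels (labelMap : LabelMap) (h₀ h₁ : Heap) : Prop :=
  ∀ (c : CellTyp) (r : MRef c), h₀.Contains r →
    h₁.Contains r ∧ labelAt labelMap h₀ r.addr = labelAt labelMap h₁ r.addr

/-! ### Basic facts on heaps -/

theorem Heap.sel_eq_some {h : Heap} {c : CellTyp} {r : MRef c} {x : c.El} :
    h.sel r = some x ↔ h.mem r.addr = some ⟨c, x⟩ := by
  unfold Heap.sel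
  split
  · rename_i hc
    have hs := hc.choose_spec
    constructor
    · intro he
      rw [← Option.some.inj he]
      exact hs
    · intro he
      have h2 := hs.symm.trans he
      simp only [Option.some.injEq, Sigma.mk.injEq, heq_eq_eq, true_and] at h2
      rw [h2]
  · rename_i hc
    constructor
    · intro he
      cases he
    · intro he
      exact absurd ⟨x, he⟩ hc

theorem Heap.contains_iff {h : Heap} {c : CellTyp} {r : MRef c} :
    h.Contains r ↔ ∃ x, h.sel r = some x := by
  simp only [Heap.sel_eq_some, Heap.Contains]

theorem Heap.sel_congr {h h' : Heap} {c : CellTyp} {r : MRef c}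
    (he : h.mem r.addr = h'.mem r.addr) : h.sel r = h'.sel r := by
  apply Option.ext
  intro x
  simp only [Heap.sel_eq_some, he]

theorem Heap.le_trans {h₀ h₁ h₂ : Heap} (h : h₀.le h₁) (h' : h₁.le h₂) : h₀.le h₂ := by
  intro c r x hx
  obtain ⟨y, hy, hxy⟩ := h c r x hx
  obtain ⟨z, hz, hyz⟩ := h' c r y hy
  exact ⟨z, hz, c.rel.trans _ _ _ hxy hyz⟩

theorem Heap.le_refl (h : Heap) : h.le h := fun c _ x hx => ⟨x, hx, c.rel.refl x⟩

theorem Heap.sel_write_self {h : Heap} {c : CellTyp} {r : MRef c} (hc : h.Contains r)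
    (x : c.El) : (h.write r hc x).sel r = some x := by
  rw [Heap.sel_eq_some]
  simp [Heap.write]

theorem Heap.sel_write_of_ne {h : Heap} {c d : CellTyp} {r : MRef c} (hc : h.Contains r)
    (x : c.El) {r' : MRef d} (hne : r'.addr ≠ r.addr) :
    (h.write r hc x).sel r' = h.sel r' := by
  apply Heap.sel_congr
  simp [Heap.write, Function.update_of_ne hne]

theorem Heap.sel_alloc_of_ne {h : Heap} {c d : CellTyp} (x : c.El) {r' : MRef d}
    (hne : r'.addr ≠ h.nextAddr) : (h.alloc x).2.sel r' = h.sel r' := by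
  apply Heap.sel_congr
  simp [Heap.alloc, Function.update_of_ne hne]

theorem Heap.sel_alloc_self {h : Heap} {c : CellTyp} (x : c.El) :
    (h.alloc x).2.sel (h.alloc x).1 = some x := by
  rw [Heap.sel_eq_some]
  simp [Heap.alloc]

theorem Heap.addr_lt {h : Heap} {c : CellTyp} {r : MRef c} (hc : h.Contains r) :
    r.addr < h.nextAddr := by
  by_contra hlt
  obtain ⟨x, hx⟩ := hc
  rw [h.unused _ (not_lt.mp hlt)] at hx
  cases hx

theorem Heap.celltyp_eq {h : Heap} {c d : CellTyp} {r : MRef c} {r' : MRef d}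
    (hc : h.Contains r) (hd : h.Contains r') (ha : r.addr = r'.addr) : c = d := by
  obtain ⟨x, hx⟩ := hc
  obtain ⟨y, hy⟩ := hd
  rw [ha, hy] at hx
  exact (congrArg Sigma.fst (Option.some.inj hx)).symm

theorem Heap.le_write {h : Heap} {c : CellTyp} {r : MRef c} (hc : h.Contains r) {x : c.El}
    (hr : ∀ y, h.sel r = some y → c.rel.rel y x) : h.le (h.write r hc x) := by
  intro d r' y hy
  by_cases ha : r'.addr = r.addr
  · obtain rfl : d = c := Heap.celltyp_eq (Heap.contains_iff.2 ⟨y, hy⟩) hc ha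
    obtain rfl : r' = r := by
      cases r'
      cases r
      exact congrArg MRef.mk ha
    exact ⟨x, Heap.sel_write_self hc x, hr y hy⟩
  · exact ⟨y, by rw [Heap.sel_write_of_ne hc x ha, hy], d.rel.refl y⟩

theorem Heap.le_alloc {h : Heap} {c : CellTyp} (x : c.El) : h.le (h.alloc x).2 := by
  intro d r' y hy
  have hne : r'.addr ≠ h.nextAddr := ne_of_lt (Heap.addr_lt (Heap.contains_iff.2 ⟨y, hy⟩))
  exact ⟨y, by rw [Heap.sel_alloc_of_ne x hne, hy], d.rel.refl y⟩

theorem Heap.le.contains {h₀ h₁ : Heap} (h : h₀.le h₁) {c : CellTyp} {r : MRef c}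
    (hc : h₀.Contains r) : h₁.Contains r := by
  obtain ⟨x, hx⟩ := Heap.contains_iff.1 hc
  obtain ⟨y, hy, -⟩ := h c r x hx
  exact Heap.contains_iff.2 ⟨y, hy⟩

theorem Heap.le.shareable {labelMap : LabelMap} {h₀ h₁ : Heap} (h : h₀.le h₁) {c : CellTyp}
    {r : MRef c} (hs : isShareable labelMap r h₀) : isShareable labelMap r h₁ := by
  unfold isShareable labelAt at hs ⊢
  rw [Option.map_eq_some_iff] at hs ⊢
  obtain ⟨m, hm, hl⟩ := hs
  obtain ⟨m', hm', hle⟩ := h _ labelMap m hm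
  refine ⟨m', hm', ?_⟩
  have h2 : (m r.addr).le (m' r.addr) := hle r.addr
  rw [hl] at h2
  revert h2
  cases m' r.addr <;> simp [Label.le]

theorem forallRefs_mono {p q : MRefPred} (hpq : ∀ c r, p c r → q c r) :
    ∀ (t : FullGroundTyp) (x : t.toType), forallRefs p t x → forallRefs q t x
  | .unit, _, _ => trivial
  | .int, _, _ => trivial
  | .bool, _, _ => trivial
  | .sum t₁ _, Sum.inl x, h => forallRefs_mono hpq t₁ x h
  | .sum _ t₂, Sum.inr x, h => forallRefs_mono hpq t₂ x h
  | .pair t₁ t₂, x, h => ⟨forallRefs_mono hpq t₁ x.1 h.1, forallRefs_mono hpq t₂ x.2 h.2⟩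
  | .ref _, _, h => hpq _ _ h
  | .llist _, LinkedList.nil, _ => trivial
  | .llist t, LinkedList.cons x _, h => ⟨forallRefs_mono hpq t x h.1, hpq _ _ h.2⟩

/-! ### The three predicates, abstract and concrete -/

/-- An invariant on heaps, a predicate on references, and a preorder on heaps. -/
structure Threep : Type 1 where
  inv : Heap → Prop
  phi : MRefPred
  hrel : PreorderRel Heap

def containedPred {c : CellTyp} (r : MRef c) : StablePred :=
  ⟨isContained r, fun _ _ hp hle => hle.contains hp⟩

def shareablePred (labelMap : LabelMap) {c : CellTyp} (r : MRef c) : StablePred :=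
  ⟨isShareable labelMap r, fun _ _ hp hle => hle.shareable hp⟩

def phiC (witnessed : HeapPred → Prop) (labelMap : LabelMap) : MRefPred :=
  fun _ r => witnessed (isContained r) ∧ witnessed (isShareable labelMap r)

def hrelC (labelMap : LabelMap) : PreorderRel Heap where
  rel h₀ h₁ := modifShareableAndEncaps labelMap h₀ h₁ ∧ sameLabels labelMap h₀ h₁
  refl h := ⟨fun _ _ _ _ _ => rfl, fun _ _ hc => ⟨hc, rfl⟩⟩
  trans h₀ h₁ h₂ h h' := by
    refine ⟨fun c r hc hne hl => ?_, fun c r hc => ?_⟩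
    · obtain ⟨hc1, hl1⟩ := h.2 c r hc
      rw [h.1 c r hc hne hl]
      apply h'.1 c r hc1 hne
      simpa only [isShareable, isEncaps, hl1] using hl
    · obtain ⟨hc1, hl1⟩ := h.2 c r hc
      obtain ⟨hc2, hl2⟩ := h'.2 c r hc1
      exact ⟨hc2, hl1.trans hl2⟩

/-- The concrete predicates: the invariant of labeled references, being (witnessed to be) contained
and shareable, and modifying only shareable and encapsulated references while keeping labels. -/
def concretePreds (witnessed : HeapPred → Prop) (labelMap : LabelMap) : Threep :=
  ⟨lrInv labelMap, phiC witnessed labelMap, hrelC labelMap⟩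

/-! ### The operations offered to unverified code -/

def PolyAlloc (witnessed : HeapPred → Prop) (preds : Threep) : Type 1 :=
  ∀ (t : FullGroundTyp) (init : t.toType), MST witnessed (Ref t)
    (fun h₀ => preds.inv h₀ ∧ forallRefs preds.phi t init)
    (fun h₀ r h₁ => preds.hrel.rel h₀ h₁ ∧ preds.inv h₁ ∧ preds.phi _ r)

def PolyRead (witnessed : HeapPred → Prop) (preds : Threep) : Type 1 :=
  ∀ (t : FullGroundTyp) (r : Ref t), MST witnessed t.toType
    (fun h₀ => preds.inv h₀ ∧ preds.phi _ r)
    (fun h₀ x h₁ => preds.hrel.rel h₀ h₁ ∧ preds.inv h₁ ∧ forallRefs preds.phi t x)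

def PolyWrite (witnessed : HeapPred → Prop) (preds : Threep) : Type 1 :=
  ∀ (t : FullGroundTyp) (r : Ref t) (x : t.toType), MST witnessed Unit
    (fun h₀ => preds.inv h₀ ∧ preds.phi _ r ∧ forallRefs preds.phi t x)
    (fun h₀ _ h₁ => preds.hrel.rel h₀ h₁ ∧ preds.inv h₁)

/-- Relabel a reference as shareable, by updating the label map. -/
def labelShareable (labelMap : LabelMap) {c : CellTyp} (r : MRef c) : MstRepr Unit :=
  .read labelMap fun m : ℕ+ → Label =>
    .write labelMap (Function.update m r.addr .shareable : ℕ+ → Label) (.ret ())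

/-- Witness that a reference is contained and shareable, then continue with `k`. -/
def witnessRef (labelMap : LabelMap) {α : Type u} {c : CellTyp} (r : MRef c) (k : MstRepr α) :
    MstRepr α :=
  .witness (containedPred r) fun _ => .witness (shareablePred labelMap r) fun _ => k

/-- Recall that a reference is contained and shareable, then continue with `k`. -/
def recallRef (labelMap : LabelMap) {α : Type u} {c : CellTyp} (r : MRef c) (k : MstRepr α) :
    MstRepr α :=
  .recallTok (containedPred r) fun _ => .recallTok (shareablePred labelMap r) fun _ => k

/-- Do `op` with each reference that occurs in a value, then continue with `k`. -/
def iterRefs {α : Type u} (op : ∀ c : CellTyp, MRef c → MstRepr α → MstRepr α) :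
    (t : FullGroundTyp) → t.toType → MstRepr α → MstRepr α
  | .unit, _, k => k
  | .int, _, k => k
  | .bool, _, k => k
  | .sum t₁ _, Sum.inl x, k => iterRefs op t₁ x k
  | .sum _ t₂, Sum.inr x, k => iterRefs op t₂ x k
  | .pair t₁ t₂, x, k => iterRefs op t₁ x.1 (iterRefs op t₂ x.2 k)
  | .ref _, x, k => op _ x k
  | .llist _, LinkedList.nil, k => k
  | .llist t, LinkedList.cons x r, k => iterRefs op t x (op _ r k)

theorem theta_witnessRefs {witnessed : HeapPred → Prop} {labelMap : LabelMap} {α : Type u}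
    {p : α → Heap → Prop} {h : Heap} :
    ∀ (t : FullGroundTyp) (x : t.toType) (k : MstRepr α),
      forallRefs (fun _ r => isContained r h ∧ isShareable labelMap r h) t x →
      (forallRefs (phiC witnessed labelMap) t x → (theta witnessed k).wp p h) →
      (theta witnessed (iterRefs (fun _ r => witnessRef labelMap r) t x k)).wp p h
  | .unit, _, _, _, hk => hk trivial
  | .int, _, _, _, hk => hk trivial
  | .bool, _, _, _, hk => hk trivial
  | .sum t₁ _, Sum.inl x, k, hx, hk => theta_witnessRefs t₁ x k hx hk
  | .sum _ t₂, Sum.inr x, k, hx, hk => theta_witnessRefs t₂ x k hx hk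
  | .pair t₁ t₂, x, k, hx, hk =>
    theta_witnessRefs t₁ x.1 _ hx.1 fun h1 =>
      theta_witnessRefs t₂ x.2 k hx.2 fun h2 => hk ⟨h1, h2⟩
  | .ref _, _, _, hx, hk => ⟨hx.1, fun w1 => ⟨hx.2, fun w2 => hk ⟨w1, w2⟩⟩⟩
  | .llist _, LinkedList.nil, _, _, hk => hk trivial
  | .llist t, LinkedList.cons x _, _, hx, hk =>
    theta_witnessRefs t x _ hx.1 fun h1 =>
      ⟨hx.2.1, fun w1 => ⟨hx.2.2, fun w2 => hk ⟨h1, w1, w2⟩⟩⟩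

theorem theta_recallRefs {witnessed : HeapPred → Prop} {labelMap : LabelMap} {α : Type u}
    {p : α → Heap → Prop} {h : Heap} :
    ∀ (t : FullGroundTyp) (x : t.toType) (k : MstRepr α),
      forallRefs (phiC witnessed labelMap) t x →
      (forallRefs (fun _ r => isContained r h ∧ isShareable labelMap r h) t x →
        (theta witnessed k).wp p h) →
      (theta witnessed (iterRefs (fun _ r => recallRef labelMap r) t x k)).wp p h
  | .unit, _, _, _, hk => hk trivial
  | .int, _, _, _, hk => hk trivial
  | .bool, _, _, _, hk => hk trivial
  | .sum t₁ _, Sum.inl x, k, hx, hk => theta_recallRefs t₁ x k hx hk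
  | .sum _ t₂, Sum.inr x, k, hx, hk => theta_recallRefs t₂ x k hx hk
  | .pair t₁ t₂, x, k, hx, hk =>
    theta_recallRefs t₁ x.1 _ hx.1 fun h1 =>
      theta_recallRefs t₂ x.2 k hx.2 fun h2 => hk ⟨h1, h2⟩
  | .ref _, _, _, hx, hk => ⟨hx.1, fun w1 => ⟨hx.2, fun w2 => hk ⟨w1, w2⟩⟩⟩
  | .llist _, LinkedList.nil, _, _, hk => hk trivial
  | .llist t, LinkedList.cons x _, _, hx, hk =>
    theta_recallRefs t x _ hx.1 fun h1 =>
      ⟨hx.2.1, fun w1 => ⟨hx.2.2, fun w2 => hk ⟨h1, w1, w2⟩⟩⟩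

theorem forallRefs_and {p q : MRefPred} :
    ∀ (t : FullGroundTyp) (x : t.toType), forallRefs p t x → forallRefs q t x →
      forallRefs (fun c r => p c r ∧ q c r) t x
  | .unit, _, _, _ => trivial
  | .int, _, _, _ => trivial
  | .bool, _, _, _ => trivial
  | .sum t₁ _, Sum.inl x, h, h' => forallRefs_and t₁ x h h'
  | .sum _ t₂, Sum.inr x, h, h' => forallRefs_and t₂ x h h'
  | .pair t₁ t₂, x, h, h' =>
    ⟨forallRefs_and t₁ x.1 h.1 h'.1, forallRefs_and t₂ x.2 h.2 h'.2⟩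
  | .ref _, _, h, h' => ⟨h, h'⟩
  | .llist _, LinkedList.nil, _, _ => trivial
  | .llist t, LinkedList.cons x _, h, h' => ⟨forallRefs_and t x h.1 h'.1, h.2, h'.2⟩

theorem mref_eq {c : CellTyp} {r r' : MRef c} (h : r.addr = r'.addr) : r = r' := by
  cases r
  cases r'
  exact congrArg MRef.mk h

theorem ground_addr_ne {labelMap : LabelMap} {h : Heap} {t : FullGroundTyp} {r : Ref t}
    (hc : h.Contains r) (hl : h.Contains labelMap) : r.addr ≠ labelMap.addr := by
  intro ha
  have := Heap.celltyp_eq hc hl ha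
  cases this

/-- Reading for unverified code: read, and hand out the tokens of what was read. -/
def ctxRead (witnessed : HeapPred → Prop) (labelMap : LabelMap) :
    PolyRead witnessed (concretePreds witnessed labelMap) := fun t r =>
  ⟨recallRef labelMap r (.read r fun x : t.toType =>
      iterRefs (fun _ r' => witnessRef labelMap r') t x (.ret x)), by
    rintro p h₀ ⟨⟨hinv, hphi⟩, hp⟩
    refine ⟨hphi.1, fun hc => ⟨hphi.2, fun hs => ?_⟩⟩
    obtain ⟨x, hx⟩ := Heap.contains_iff.1 hc
    refine ⟨x, hx, ?_⟩
    apply theta_witnessRefs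
    · exact forallRefs_and t x (hinv.1 t r x hx hc) (hinv.2.1 t r x hx hs)
    · intro hx2
      exact hp x h₀ ⟨h₀.le_refl, (hrelC labelMap).refl h₀, hinv, hx2⟩⟩

/-- Writing for unverified code. -/
def ctxWrite (witnessed : HeapPred → Prop) (labelMap : LabelMap) :
    PolyWrite witnessed (concretePreds witnessed labelMap) := fun t r x =>
  ⟨recallRef labelMap r (iterRefs (fun _ r' => recallRef labelMap r') t x
      (.write (c := .ground t) r x (.ret ()))), by
    rintro p h₀ ⟨⟨hinv, hphi, hx⟩, hp⟩
    refine ⟨hphi.1, fun hc => ⟨hphi.2, fun hs => ?_⟩⟩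
    apply theta_recallRefs t x _ hx
    intro hx2
    replace hc : h₀.Contains r := hc
    have hle : h₀.le (h₀.write (c := .ground t) r hc x) := Heap.le_write hc fun _ _ => trivial
    refine ⟨hc, fun _ _ => trivial, hp () _ ⟨hle, ?_⟩⟩
    obtain ⟨hi1, hi2, hi3, hi4, hi5⟩ := hinv
    have hne : r.addr ≠ labelMap.addr := ground_addr_ne hc hi3
    have hlab : ∀ a, labelAt labelMap (h₀.write (c := .ground t) r hc x) a
        = labelAt labelMap h₀ a := by
      intro a
      unfold labelAt
      rw [Heap.sel_write_of_ne hc x (Ne.symm hne)]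
    have key : ∀ (t' : FullGroundTyp) (r' : Ref t') (x' : t'.toType),
        (h₀.write (c := .ground t) r hc x).sel r' = some x' →
        (forallRefs (fun _ r => isContained r h₀ ∧ isShareable labelMap r h₀) t' x') ∨
          h₀.sel r' = some x' := by
      intro t' r' x' hx'
      by_cases ha : r'.addr = r.addr
      · left
        have hcc := Heap.celltyp_eq (Heap.contains_iff.2 ⟨x', hx'⟩) (hle.contains hc) ha
        cases hcc
        obtain rfl := mref_eq ha
        rw [Heap.sel_write_self hc x] at hx'
        cases hx'
        exact hx2
      · right
        rw [← hx', Heap.sel_write_of_ne hc x ha]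
    refine ⟨⟨?_, ?_⟩, ?_, ?_, hle.contains hi3, ?_, ?_⟩
    · intro d r' hd _ hl
      by_cases ha : r'.addr = r.addr
      · exfalso
        apply hl
        left
        replace hs : labelAt labelMap h₀ r.addr = some .shareable := hs
        simpa only [isShareable, ha] using hs
      · rw [Heap.sel_write_of_ne hc x ha]
    · intro d r' hd
      exact ⟨hle.contains hd, (hlab _).symm⟩
    · intro t' r' x' hx' _
      rcases key t' r' x' hx' with hk | hk
      · exact forallRefs_mono (fun _ _ hh => hle.contains hh.1) _ _ hk
      · exact forallRefs_mono (fun _ _ hh => hle.contains hh) _ _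
          (hi1 t' r' x' hk (Heap.contains_iff (c := .ground t').2 ⟨x', hk⟩))
    · intro t' r' x' hx' hs'
      rcases key t' r' x' hx' with hk | hk
      · exact forallRefs_mono (fun _ _ hh => hle.shareable hh.2) _ _ hk
      · refine forallRefs_mono (fun _ _ hh => hle.shareable hh) _ _ (hi2 t' r' x' hk ?_)
        simpa only [isShareable, hlab] using hs'
    · unfold isPrivateAddr
      rw [hlab]
      exact hi4
    · intro a ha
      unfold isPrivateAddr
      rw [hlab]
      exact hi5 a ha⟩

/-- Allocation for unverified code: allocate a reference and label it as shareable. -/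
def ctxAlloc (witnessed : HeapPred → Prop) (labelMap : LabelMap) :
    PolyAlloc witnessed (concretePreds witnessed labelMap) := fun t init =>
  ⟨iterRefs (fun _ r' => recallRef labelMap r') t init
      (.alloc (c := .ground t) init fun r =>
        (labelShareable labelMap r).bind fun _ => witnessRef labelMap r (.ret r)), by
    rintro p h₀ ⟨⟨hinv, hinit⟩, hp⟩
    apply theta_recallRefs t init _ hinit
    intro hx2
    obtain ⟨hi1, hi2, hi3, hi4, hi5⟩ := hinv
    obtain ⟨m, hm⟩ := Heap.contains_iff.1 hi3
    have hlm : labelMap.addr ≠ h₀.nextAddr := ne_of_lt (Heap.addr_lt hi3)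
    obtain ⟨r, h₁, he⟩ : ∃ r h₁, h₀.alloc (c := .ground t) init = (r, h₁) := ⟨_, _, rfl⟩
    have hle1 : h₀.le h₁ := by
      have := Heap.le_alloc (h := h₀) (c := .ground t) init
      rwa [he] at this
    have hselr : h₁.sel r = some init := by
      have := Heap.sel_alloc_self (h := h₀) (c := .ground t) init
      rwa [he] at this
    have hrn : r.addr = h₀.nextAddr := by
      have : (h₀.alloc (c := .ground t) init).1.addr = h₀.nextAddr := rfl
      rwa [he] at this
    have hnext : h₁.nextAddr = h₀.nextAddr + 1 := by
      have : (h₀.alloc (c := .ground t) init).2.nextAddr = h₀.nextAddr + 1 := rfl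
      rwa [he] at this
    have hold : ∀ {d : CellTyp} {r' : MRef d}, r'.addr ≠ h₀.nextAddr →
        h₁.sel r' = h₀.sel r' := by
      intro d r' hne
      have := Heap.sel_alloc_of_ne (h := h₀) (c := .ground t) init hne
      rwa [he] at this
    have hm1 : h₁.sel labelMap = some m := by rw [hold hlm, hm]
    have hc1 : h₁.Contains labelMap := hle1.contains hi3
    change (theta witnessed ((labelShareable labelMap (h₀.alloc (c := .ground t) init).1).bind
      fun _ => witnessRef labelMap (h₀.alloc (c := .ground t) init).1
        (.ret (h₀.alloc (c := .ground t) init).1))).wp p (h₀.alloc (c := .ground t) init).2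
    rw [he]
    have hrel : ∀ y, h₁.sel labelMap = some y →
        labelPreorder.rel y (Function.update m r.addr .shareable) := by
      intro y hy a
      rw [hm1] at hy
      cases hy
      by_cases ha : a = r.addr
      · have h5 := hi5 r.addr hrn.ge
        unfold isPrivateAddr labelAt at h5
        rw [hm] at h5
        have h6 : m r.addr = .priv := Option.some.inj h5
        rw [ha, h6]
        trivial
      · rw [Function.update_of_ne ha]
        exact labelPreorder.refl m a
    refine ⟨m, hm1, hc1, hrel, ?_⟩
    have hle2 := Heap.le_write hc1 hrel
    have hsm := Heap.sel_write_self hc1 (Function.update m r.addr .shareable : ℕ+ → Label)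
    have hold2 : ∀ {d : CellTyp} {r' : MRef d}, r'.addr ≠ labelMap.addr →
        (h₁.write labelMap hc1 (Function.update m r.addr .shareable : ℕ+ → Label)).sel r'
          = h₁.sel r' :=
      fun hne => Heap.sel_write_of_ne hc1 _ hne
    have hn2 : (h₁.write labelMap hc1
        (Function.update m r.addr .shareable : ℕ+ → Label)).nextAddr = h₁.nextAddr := rfl
    change (theta witnessed (witnessRef labelMap r (.ret r))).wp p
      (h₁.write labelMap hc1 (Function.update m r.addr .shareable : ℕ+ → Label))
    generalize h₁.write labelMap hc1 (Function.update m r.addr .shareable : ℕ+ → Label) = h₂ at *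
    have hle : h₀.le h₂ := Heap.le_trans hle1 hle2
    have hrlm : r.addr ≠ labelMap.addr := by
      rw [hrn]
      exact hlm.symm
    have hlab : ∀ a, a ≠ r.addr → labelAt labelMap h₂ a = labelAt labelMap h₀ a := by
      intro a ha
      unfold labelAt
      rw [hsm, hm]
      simp [Function.update_of_ne ha]
    have hsr : isShareable labelMap r h₂ := by
      unfold isShareable labelAt
      rw [hsm]
      simp
    have hcr : h₂.Contains r := hle2.contains (Heap.contains_iff.2 ⟨init, hselr⟩)
    refine ⟨hcr, fun w1 => ⟨hsr, fun w2 => hp r h₂ ⟨hle, ?_⟩⟩⟩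
    have key : ∀ (t' : FullGroundTyp) (r' : Ref t') (x' : t'.toType),
        h₂.sel r' = some x' →
        (forallRefs (fun _ r => isContained r h₀ ∧ isShareable labelMap r h₀) t' x') ∨
          (h₀.sel r' = some x' ∧ r'.addr ≠ r.addr) := by
      intro t' r' x' hx'
      have hc2 : h₂.Contains r' := Heap.contains_iff.2 ⟨x', hx'⟩
      have hne2 : r'.addr ≠ labelMap.addr := ground_addr_ne hc2 (hle.contains hi3)
      by_cases ha : r'.addr = r.addr
      · left
        have hcc := Heap.celltyp_eq hc2 hcr ha
        cases hcc
        obtain rfl := mref_eq ha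
        rw [hold2 hrlm, hselr] at hx'
        cases hx'
        exact hx2
      · right
        refine ⟨?_, ha⟩
        rw [← hx', hold2 hne2, hold (by rwa [← hrn])]
    have hlt : ∀ {d : CellTyp} {r' : MRef d}, h₀.Contains r' → r'.addr ≠ r.addr := by
      intro d r' hd
      rw [hrn]
      exact ne_of_lt (Heap.addr_lt hd)
    refine ⟨⟨?_, ?_⟩, ⟨?_, ?_, hle.contains hi3, ?_, ?_⟩, w1, w2⟩
    · intro d r' hd hne _
      have := hlt hd
      rw [hold2 hne, hold (by rwa [← hrn])]
    · intro d r' hd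
      exact ⟨hle.contains hd, (hlab _ (hlt hd)).symm⟩
    · intro t' r' x' hx' _
      rcases key t' r' x' hx' with hk | ⟨hk, -⟩
      · exact forallRefs_mono (fun _ _ hh => hle.contains hh.1) _ _ hk
      · exact forallRefs_mono (fun _ _ hh => hle.contains hh) _ _
          (hi1 t' r' x' hk (Heap.contains_iff (c := .ground t').2 ⟨x', hk⟩))
    · intro t' r' x' hx' hs'
      rcases key t' r' x' hx' with hk | ⟨hk, hne⟩
      · exact forallRefs_mono (fun _ _ hh => hle.shareable hh.2) _ _ hk
      · refine forallRefs_mono (fun _ _ hh => hle.shareable hh) _ _ (hi2 t' r' x' hk ?_)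
        unfold isShareable at hs' ⊢
        rwa [hlab _ hne] at hs'
    · unfold isPrivateAddr
      rw [hlab _ hrlm.symm]
      exact hi4
    · intro a ha
      rw [hn2, hnext] at ha
      have hlt' : h₀.nextAddr < a := lt_of_lt_of_le (PNat.lt_add_right _ _) ha
      unfold isPrivateAddr
      rw [hlab _ (by rw [hrn]; exact ne_of_gt hlt')]
      exact hi5 a hlt'.le⟩

/-! ### Interfaces of unverified code -/

/-- Errors raised by contracts that fail. -/
structure Err : Type where
  msg : String

/-- Types whose values can be searched for references: `everyMref φ x` says that all references met
when decomposing `x` satisfy `φ` (references are not followed, functions are not inspected). -/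
class EveryMref (α : Type u) : Type (max 1 u) where
  everyMref : MRefPred → α → Prop

instance : EveryMref Unit := ⟨fun _ _ => True⟩

instance : EveryMref ℤ := ⟨fun _ _ => True⟩

instance : EveryMref Bool := ⟨fun _ _ => True⟩

instance : EveryMref Err := ⟨fun _ _ => True⟩

instance {α : Type u} {β : Type v} [EveryMref α] [EveryMref β] : EveryMref (α ⊕ β) :=
  ⟨fun φ x => Sum.elim (EveryMref.everyMref φ) (EveryMref.everyMref φ) x⟩

instance {α : Type u} {β : Type v} [EveryMref α] [EveryMref β] : EveryMref (α × β) :=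
  ⟨fun φ x => EveryMref.everyMref φ x.1 ∧ EveryMref.everyMref φ x.2⟩

instance {α : Type u} [EveryMref α] : EveryMref (Option α) :=
  ⟨fun φ x => ∀ y ∈ x, EveryMref.everyMref φ y⟩

instance {α : Type u} [EveryMref α] : EveryMref (List α) :=
  ⟨fun φ x => ∀ y ∈ x, EveryMref.everyMref φ y⟩

instance {α : Type u} [EveryMref α] : EveryMref (ULift.{v} α) :=
  ⟨fun φ x => EveryMref.everyMref φ x.down⟩

instance {t : FullGroundTyp} : EveryMref (Ref t) := ⟨fun φ r => φ _ r⟩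

instance {t : FullGroundTyp} : EveryMref (LinkedList t t.toType) :=
  ⟨fun φ x => forallRefs φ (.llist t) x⟩

instance {α : Type u} {β : α → Type v} : EveryMref ((x : α) → β x) := ⟨fun _ _ => True⟩

/-- The pre-condition of functions on the interface of unverified code. -/
def polyPre (preds : Threep) {α : Type u} [EveryMref α] (x : α) (h₀ : Heap) : Prop :=
  preds.inv h₀ ∧ EveryMref.everyMref preds.phi x

/-- The post-condition of functions on the interface of unverified code. -/
def polyPost (preds : Threep) {α : Type u} [EveryMref α] (h₀ : Heap) (x : α) (h₁ : Heap) : Prop :=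
  preds.inv h₁ ∧ preds.hrel.rel h₀ h₁ ∧ EveryMref.everyMref preds.phi x

/-- Types that may appear on the interface of unverified code. -/
class PolyIface (preds : Threep) (α : Type u) : Type (max 1 u) where
  wt : EveryMref α

namespace PolyIface

variable (preds : Threep)

instance instUnit : PolyIface preds Unit := ⟨inferInstance⟩

instance instInt : PolyIface preds ℤ := ⟨inferInstance⟩

instance instBool : PolyIface preds Bool := ⟨inferInstance⟩

instance instErr : PolyIface preds Err := ⟨inferInstance⟩

instance instSum (α : Type u) (β : Type v) [c₁ : PolyIface preds α] [c₂ : PolyIface preds β] :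
    PolyIface preds (α ⊕ β) :=
  letI := c₁.wt
  letI := c₂.wt
  ⟨inferInstance⟩

instance instProd (α : Type u) (β : Type v) [c₁ : PolyIface preds α] [c₂ : PolyIface preds β] :
    PolyIface preds (α × β) :=
  letI := c₁.wt
  letI := c₂.wt
  ⟨inferInstance⟩

instance instOption (α : Type u) [c : PolyIface preds α] : PolyIface preds (Option α) :=
  letI := c.wt
  ⟨inferInstance⟩

instance instList (α : Type u) [c : PolyIface preds α] : PolyIface preds (List α) :=
  letI := c.wt
  ⟨inferInstance⟩

instance instULift (α : Type u) [c : PolyIface preds α] : PolyIface preds (ULift.{v} α) :=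
  letI := c.wt
  ⟨inferInstance⟩

instance instRef (t : FullGroundTyp) : PolyIface preds (Ref t) := ⟨inferInstance⟩

instance instLinkedList (t : FullGroundTyp) : PolyIface preds (LinkedList t t.toType) :=
  ⟨inferInstance⟩

end PolyIface

/-- Functions on the interface of unverified code. -/
abbrev PolyArrow (witnessed : HeapPred → Prop) (preds : Threep) (α : Type u) (β : Type v)
    [EveryMref α] [EveryMref β] : Type (max 1 u v) :=
  (x : α) → MST witnessed β (polyPre preds x) (polyPost preds)

instance PolyIface.instArrow (witnessed : HeapPred → Prop) (preds : Threep) (α : Type u)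
    (β : Type v) [c₁ : PolyIface preds α] [c₂ : PolyIface preds β] :
    PolyIface preds (letI := c₁.wt; letI := c₂.wt; PolyArrow witnessed preds α β) :=
  letI := c₁.wt
  letI := c₂.wt
  ⟨inferInstanceAs (EveryMref (PolyArrow witnessed preds α β))⟩

/-! ### Higher-order contracts -/

/-- An exported function needs a check of its pre-condition, an imported one a check of its
post-condition. -/
inductive Direction : Type
  | exported
  | imported

/-- The pre- and the post-condition of a function from `arg` to `ret` (or an error) that appears on
an interface. -/
structure Spec (preds : Threep) : Type (u + 1) where
  dir : Direction
  arg : Type u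
  ret : Type u
  wtArg : EveryMref arg
  wtRet : EveryMref ret
  pre : arg → Heap → Prop
  post : arg → Heap → ret ⊕ Err → Heap → Prop

attribute [instance] Spec.wtArg Spec.wtRet

/-- The type of a function with a given specification. -/
abbrev Spec.Fun (witnessed : HeapPred → Prop) {preds : Threep} (s : Spec.{u} preds) :
    Type (max 1 u) :=
  (x : s.arg) → MST witnessed (s.ret ⊕ Err) (s.pre x) (s.post x)

/-- The specifications on an interface, structured as a tree. -/
inductive SpecTree (preds : Threep) : Type (u + 1)
  | leaf
  | emptyNode (left right : SpecTree preds)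
  | node (s : Spec.{u} preds) (left right : SpecTree preds)

/-- Contracts that enforce a pre-condition: on success, it holds. -/
abbrev PreCheck (witnessed : HeapPred → Prop) {preds : Threep} (s : Spec.{u} preds) :
    Type (max 1 u) :=
  (x : s.arg) → MST witnessed (Unit ⊕ Err) (polyPre preds x)
    (fun h₀ r h₁ => h₀ = h₁ ∧ (r.isLeft → s.pre x h₀))

/-- `cb` can be run on the result of a function called on `x` in the heap `eh`, and on success
the post-condition holds. -/
def IsPostCheck (witnessed : HeapPred → Prop) {preds : Threep} (s : Spec.{u} preds) (x : s.arg)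
    (eh : Heap) (cb : s.ret ⊕ Err → MstRepr (Unit ⊕ Err)) : Prop :=
  ∀ r, (theta witnessed (cb r)).Refines
    (hoareW (fun h₁ => polyPost preds eh r h₁)
      (fun h₁ rck h₁' => h₁ = h₁' ∧ (rck.isLeft → s.post x eh r h₁)))

/-- Stateful contracts that enforce a post-condition: before the call, they read from the heap and
return a callback (possibly storing what has been read), which checks the post-condition after the
call.  The heap before the call is computationally irrelevant (erased): it only occurs in the
specification of the callback. -/
abbrev SelectCheck (witnessed : HeapPred → Prop) {preds : Threep} (s : Spec.{u} preds) :
    Type (max 1 u) :=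
  (x : s.arg) → MST witnessed (s.ret ⊕ Err → MstRepr (Unit ⊕ Err)) (s.pre x)
    (fun h₀ cb h₁ => h₀ = h₁ ∧ IsPostCheck witnessed s x h₀ cb)

/-- The contract required for a specification. -/
def Hoc (witnessed : HeapPred → Prop) {preds : Threep} (s : Spec.{u} preds) : Type (max 1 u) :=
  match s.dir with
  | .exported => PreCheck witnessed s
  | .imported => SelectCheck witnessed s

/-- Trees of contracts, one for each specification of a tree of specifications. -/
def HocTree (witnessed : HeapPred → Prop) {preds : Threep} : SpecTree.{u} preds → Type (max 1 u)
  | .leaf => PUnit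
  | .emptyNode l r => HocTree witnessed l × HocTree witnessed r
  | .node s l r => Hoc witnessed s × HocTree witnessed l × HocTree witnessed r

/-- `styp` is the source counterpart of an intermediate type `ityp` of the interface of unverified
code, and enforcing the contracts turns each value of type `ityp` into one of type `styp`, without
raising an error at this point. -/
class SafeImportableTo (witnessed : HeapPred → Prop) (preds : Threep) (styp : Type u)
    (specs : SpecTree.{w} preds) : Type (max 1 u (v + 1) w) where
  cStyp : EveryMref styp
  ityp : Type v
  cItyp : PolyIface preds ityp
  safeImport : ityp → HocTree witnessed specs → styp
  safeImport_preserves : ∀ (x : ityp) (φ : MRefPred) (hocs : HocTree witnessed specs),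
    cItyp.wt.everyMref φ x → cStyp.everyMref φ (safeImport x hocs)

/-! ### Source language -/

/-- Semantics of whole programs: relations between the initial heap, the result and the final heap. -/
abbrev StateSem : Type 1 := Heap → ℤ → Heap → Prop

structure SrcInterface (witnessed : HeapPred → Prop) (labelMap : LabelMap) :
    Type (max 1 (u + 1) (v + 1) (w + 1)) where
  ctype : Threep → Type u
  specsOfCtype : (preds : Threep) → SpecTree.{w} preds
  hocs : HocTree witnessed (specsOfCtype (concretePreds witnessed labelMap))
  impCtype : (preds : Threep) →
    SafeImportableTo.{u, v, w} witnessed preds (ctype preds) (specsOfCtype preds)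
  ψ : StateSem

/-- Partial source programs: computations that take a context and are verified against the
post-condition of the interface. -/
def SrcProg {witnessed : HeapPred → Prop} {labelMap : LabelMap}
    (I : SrcInterface.{u, v, w} witnessed labelMap) : Type (max 1 u) :=
  I.ctype (concretePreds witnessed labelMap) → LR witnessed labelMap ℤ (fun _ => True) I.ψ

/-! ### Target language -/

structure TgtInterface : Type (max 1 (v + 1)) where
  ctype : Threep → Type v
  intermCtype : (preds : Threep) → PolyIface preds (ctype preds)

/-- Target contexts: unverified code, polymorphic in the three predicates, with the operations on
references as arguments. -/
def TgtCtx (witnessed : HeapPred → Prop) (I : TgtInterface.{v}) : Type (max 1 v) :=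
  ∀ (inv : Heap → Prop) (phi : MRefPred) (hrel : PreorderRel Heap),
    PolyAlloc witnessed ⟨inv, phi, hrel⟩ → PolyRead witnessed ⟨inv, phi, hrel⟩ →
      PolyWrite witnessed ⟨inv, phi, hrel⟩ → I.ctype ⟨inv, phi, hrel⟩

/-- Partial target programs: computations that take an instantiated context, with the trivial
post-condition. -/
def TgtProg (witnessed : HeapPred → Prop) (labelMap : LabelMap) (I : TgtInterface.{v}) :
    Type (max 1 v) :=
  I.ctype (concretePreds witnessed labelMap) →
    LR witnessed labelMap ℤ (fun _ => True) (fun _ _ _ => True)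

/-- Whole target programs. -/
def TgtWhole (witnessed : HeapPred → Prop) (labelMap : LabelMap) : Type 1 :=
  Unit → LR witnessed labelMap ℤ (fun _ => True) (fun _ _ _ => True)

/-- Target linking `C[P]`: instantiate the context with the concrete predicates and operations, and
hand it to the program. -/
def TgtProg.link {witnessed : HeapPred → Prop} {labelMap : LabelMap} {I : TgtInterface.{v}}
    (P : TgtProg witnessed labelMap I) (C : TgtCtx witnessed I) : TgtWhole witnessed labelMap :=
  fun _ => P (C (lrInv labelMap) (phiC witnessed labelMap) (hrelC labelMap)
    (ctxAlloc witnessed labelMap) (ctxRead witnessed labelMap) (ctxWrite witnessed labelMap))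

/-! ### Compilation and semantics -/

def SrcInterface.compile {witnessed : HeapPred → Prop} {labelMap : LabelMap}
    (I : SrcInterface.{u, v, w} witnessed labelMap) : TgtInterface.{v} where
  ctype preds := (I.impCtype preds).ityp
  intermCtype preds := (I.impCtype preds).cItyp

/-- Forget the post-condition of a computation. -/
def LR.forgetPost {witnessed : HeapPred → Prop} {labelMap : LabelMap} {α : Type u}
    {pre : Heap → Prop} {post : Heap → α → Heap → Prop} (c : LR witnessed labelMap α pre post) :
    LR witnessed labelMap α pre (fun _ _ _ => True) :=
  ⟨c.1, fun p h₀ h => c.2 p h₀ ⟨h.1, fun x h₁ hx => h.2 x h₁ ⟨hx.1, hx.2.1, trivial⟩⟩⟩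

/-- Compilation of partial programs: add the higher-order contracts to the context, then run the
source program on it. -/
def SrcProg.compile {witnessed : HeapPred → Prop} {labelMap : LabelMap}
    {I : SrcInterface.{u, v, w} witnessed labelMap} (P : SrcProg I) :
    TgtProg witnessed labelMap I.compile :=
  fun C => (P ((I.impCtype (concretePreds witnessed labelMap)).safeImport C I.hocs)).forgetPost

/-- The final states that satisfy all the post-conditions that the computation guarantees. -/
def behMst (witnessed : HeapPred → Prop) (m : MstRepr ℤ) : StateSem :=
  fun h₀ r h₁ => ∀ p : ℤ → Heap → Prop, (theta witnessed m).wp p h₀ → p r h₁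

/-- The semantics of whole programs, through their underlying monadic representation. -/
def beh {witnessed : HeapPred → Prop} {labelMap : LabelMap} (W : TgtWhole witnessed labelMap) :
    StateSem :=
  behMst witnessed (W ()).1

end SecRef

end

open SecRef

open SecRef

/-! Soundness is intrinsic to the types. A verified partial program sends every value of the source
context type to a computation tree paired with a proof that `theta` of this tree refines the Hoare
transformer with pre-condition `lrInv` and post-condition `lrInv` together with `I.ψ`. This proof is
available for every argument, so in particular for the one that is built from an unverified context.

Two observations turn this into a statement about behaviors. The relation `behMst` is the
intersection of all post-conditions that `theta` guarantees from the given initial heap; it is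
therefore contained in any one of them, and the refinement proof exhibits the desired post-condition
as one of them. Moreover, compiling and linking do not alter the tree: compiling precomposes the
source program with `safeImport` and `LR.forgetPost` weakens only the proof component, while linking
instantiates the context and passes it on. The whole target program thus has the same tree as the
source program run on the imported context, and the stronger proof about that tree can be used again
although the type of the whole program has forgotten it.

No analysis of the context is needed at this point. The mathematical work lies in forming the
argument of the program: `ctxAlloc`, `ctxRead` and `ctxWrite` meet their abstract specifications at
the concrete predicates, so that the context can be instantiated with them, and `safeImport` with
the contracts turns the outcome into a value of the type that the source program expects. The
witness tokens may be any propositions, since the same `witnessed` occurs in the refinement proof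
and in the behavior. -/

/-- Behaviors of a computation satisfy every post-condition that it guarantees. -/
theorem SecRef.behMst_of_hoare {witnessed : HeapPred → Prop} {pre : Heap → Prop}
    {post : Heap → ℤ → Heap → Prop} (m : MST witnessed ℤ pre post) {h₀ h₁ : Heap} {r : ℤ}
    (hpre : pre h₀) (hbeh : behMst witnessed m.1 h₀ r h₁) : post h₀ r h₁ :=
  -- Fixing the initial heap makes the two-heap post-condition a predicate on results and final
  -- heaps, as quantified over in `behMst`. The Hoare transformer also offers that the heap has
  -- evolved along `Heap.le`; the projection `h.2` drops this and keeps the post-condition.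
  hbeh (post h₀) (m.2 (post h₀) h₀ ⟨hpre, fun _ _ h => h.2⟩)

/-- The invariant on the initial heap is what makes the refinement proof applicable. On a heap where
`theta` guarantees no post-condition at all, the intersection defining the behavior is empty, so
that every result and final heap would count as a behavior. -/
theorem theorem3 (witnessed : HeapPred → Prop) (labelMap : LabelMap)
    (I : SrcInterface.{u, v, w} witnessed labelMap) (P : SrcProg I)
    (C : TgtCtx witnessed I.compile) :
    ∀ (h₀ : Heap) (r : ℤ) (h₁ : Heap), lrInv labelMap h₀ →
      beh (P.compile.link C) h₀ r h₁ → I.ψ h₀ r h₁ := by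
  intro h₀ r h₁ hinv hbeh
  -- This is the argument that linking supplies. Its type unfolds to the intermediate type of the
  -- interface at `concretePreds`, which is the domain of `safeImport`.
  let c := C (lrInv labelMap) (phiC witnessed labelMap) (hrelC labelMap)
    (ctxAlloc witnessed labelMap) (ctxRead witnessed labelMap) (ctxWrite witnessed labelMap)
  -- The computation is taken before `LR.forgetPost`, while its type still carries `I.ψ`; the second
  -- component of the linked program itself would yield only the trivial post-condition.
  let m := P ((I.impCtype (concretePreds witnessed labelMap)).safeImport c I.hocs)
  -- Here `hbeh` is accepted by definitional unfolding: the tree underlying the linked program is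
  -- `m.1`. The effect `LR` adds the invariant on both sides, hence the pair with `trivial` for the
  -- pre-condition, and the final projection, which discards the invariant of the final heap and
  -- leaves `I.ψ`.
  exact (behMst_of_hoare m ⟨hinv, trivial⟩ hbeh).2
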